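/- Consider intuitionistic (minimal) first-order logic over an arbitrary first-order signature: formulas are built from prime formulas (atoms) $p$ and the true formula $\top$ by $\wedge,\vee,\to,\forall,\exists$, absurdity, if wanted, being one of the atoms; formulas are taken up to renaming of bound variables. Proofs are natural deduction proofs, written as terms of a typed $\lambda$-calculus with unit, product, function and sum types and with introduction and elimination terms for $\forall$ and $\exists$; $=_{\beta\eta}$ is the congruence on proofs generated by the $\beta$- and $\eta$-equations of all connectives and quantifiers (for $\vee$ and $\exists$ the $\eta$-equations are $p\{q/a\}=\mathrm{case}\ q\ \mathrm{of}\ (b.\,p\{\mathrm{inl}\,b/a\}\mid b.\,p\{\mathrm{inr}\,b/a\})$ and $p\{q/a\}=\mathrm{dest}\ q\ \mathrm{as}\ (x,b)\ \mathrm{in}\ p\{(x,b)/a\}$, and for $\top$ every proof of $\top$ equals the canonical one). Formulas $F$ and $G$ are isomorphic, $F\cong G$, if there are closed proofs $\phi$ of $F\to G$ and $\psi$ of $G\to F$ with $\lambda a.\,\psi(\phi\,a)=_{\beta\eta}\lambda a.\,a$ and $\lambda c.\,\phi(\psi\,c)=_{\beta\eta}\lambda c.\,c$. Define the classes of formulas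 $\Sigma$, $\Pi$ and $\mathcal B$ simultaneously and inductively by \begin{align*} \Sigma\ni d &::= c_1\vee\cdots\vee c_n && (n\ge 2),\\ \Pi\ni c &::= \forall\vec x_1(c_1\to b_1)\wedge\cdots\wedge\forall\vec x_n(c_n\to b_n) && (n\ge 0),\\ \mathcal B\ni b &::= p \mid d \mid \exists\vec y\,c, \end{align*} where $p$ ranges over prime formulas, the $\vec x_i$ are finite, possibly empty, lists of individual variables, $\vec y$ is a finite non-empty list of individual variables, conjunctions and disjunctions associate to the right, and the empty conjunction is $\top$. **Theorem.** For every first-order formula $F$ there is a formula $e\in\Sigma\cup\Pi$ with $F\cong e$. -/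

import Mathlib

/-! Intuitionistic (minimal) first-order logic with primitive `⊤, ∧, ∨, →, ∀, ∃`, its natural
deduction proof terms (a typed lambda calculus), beta-eta identity of proofs, isomorphism of
formulas, and the formula classes `Σ`, `Π` and their bases. There is no logical constant for
absurdity: it is an atom like any other. -/

namespace IntHierarchy

universe u v

/-! ### Formulas

Individual variables are de Bruijn indices: in `all A` and `ex A` the index `0` of `A` is bound,
and the index `n + 1` of `A` is the index `n` outside. Thus formulas are taken up to renaming of
bound variables, and the free variables range over the infinite set `ℕ`. -/

inductive Formula (L : FirstOrder.Language.{u, v}) : Type (max u v)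
  | rel {k : ℕ} (R : L.Relations k) (ts : Fin k → L.Term ℕ) : Formula L
  | top : Formula L
  | and (A B : Formula L) : Formula L
  | or (A B : Formula L) : Formula L
  | imp (A B : Formula L) : Formula L
  | all (A : Formula L) : Formula L
  | ex (A : Formula L) : Formula L

section Individuals

variable {L : FirstOrder.Language.{u, v}}

/-- The substitution that acts like `σ` below one binder of an individual variable. -/
def iUp (σ : ℕ → L.Term ℕ) : ℕ → L.Term ℕ
  | 0 => FirstOrder.Language.Term.var 0
  | n + 1 => (σ n).relabel Nat.succ

/-- The weakening `n ↦ n + 1` of individual variables. -/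
def iShift : ℕ → L.Term ℕ := fun n => FirstOrder.Language.Term.var (n + 1)

/-- The substitution of `a` for the individual variable `0`, which is removed. -/
def iInst (a : L.Term ℕ) : ℕ → L.Term ℕ
  | 0 => a
  | n + 1 => FirstOrder.Language.Term.var n

end Individuals

namespace Formula

variable {L : FirstOrder.Language.{u, v}}

/-- Capture-avoiding simultaneous substitution of terms for the individual variables. -/
def subst : Formula L → (ℕ → L.Term ℕ) → Formula L
  | rel R ts, σ => rel R (fun i => (ts i).subst σ)
  | top, _ => top
  | and A B, σ => and (A.subst σ) (B.subst σ)
  | or A B, σ => or (A.subst σ) (B.subst σ)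
  | imp A B, σ => imp (A.subst σ) (B.subst σ)
  | all A, σ => all (A.subst (iUp σ))
  | ex A, σ => ex (A.subst (iUp σ))

/-- `A`, read below one more binder whose variable does not occur in `A`. -/
def lift (A : Formula L) : Formula L := A.subst iShift

/-- `A{a/x}`, where `x` is the individual variable `0`. -/
def inst (A : Formula L) (a : L.Term ℕ) : Formula L := A.subst (iInst a)

/-- `∀ x₁ … ∀ xₖ A`. -/
def alls : ℕ → Formula L → Formula L
  | 0, A => A
  | k + 1, A => all (alls k A)

/-- `∃ x₁ … ∃ xₖ A`. -/
def exs : ℕ → Formula L → Formula L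
  | 0, A => A
  | k + 1, A => ex (exs k A)

/-- `A₁ ∧ (A₂ ∧ (⋯ ∧ Aₙ))` for `n ≥ 0`; it is `⊤` for `n = 0` and `A₁` for `n = 1`. -/
def conj : List (Formula L) → Formula L
  | [] => top
  | [A] => A
  | A :: B :: l => and A (conj (B :: l))

/-- `A₁ ∨ (A₂ ∨ (⋯ ∨ Aₙ))` for `n ≥ 1`, with the first disjunct as a separate argument. -/
def disj : Formula L → List (Formula L) → Formula L
  | A, [] => A
  | A, B :: l => or A (disj B l)

end Formula

/-! ### Proof terms

Proof terms have de Bruijn indices for proof variables (hypotheses) and, separately, for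
individual variables. -/

inductive Proof (L : FirstOrder.Language.{u, v}) : Type (max u v)
  | var (n : ℕ) : Proof L
  | unit : Proof L
  | pair (p q : Proof L) : Proof L
  | fst (p : Proof L) : Proof L
  | snd (p : Proof L) : Proof L
  /-- `inl B p` proves `A ∨ B` if `p` proves `A`. -/
  | inl (B : Formula L) (p : Proof L) : Proof L
  /-- `inr A p` proves `A ∨ B` if `p` proves `B`. -/
  | inr (A : Formula L) (p : Proof L) : Proof L
  /-- `case q of (a. r | b. s)`; one proof variable is bound in `r`, and one in `s`. -/
  | orE (q r s : Proof L) : Proof L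
  /-- `λ a : A. p`; one proof variable is bound in `p`. -/
  | lam (A : Formula L) (p : Proof L) : Proof L
  | app (p q : Proof L) : Proof L
  /-- `λ x. p`; one individual variable is bound in `p`. -/
  | allI (p : Proof L) : Proof L
  | allE (p : Proof L) (a : L.Term ℕ) : Proof L
  /-- `⟨a, p⟩` as a proof of `∃ x A`. -/
  | exI (A : Formula L) (a : L.Term ℕ) (p : Proof L) : Proof L
  /-- `dest q as (x, b) in r`; one individual and one proof variable are bound in `r`. -/
  | exE (q r : Proof L) : Proof L

namespace Proof

variable {L : FirstOrder.Language.{u, v}}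

/-- Simultaneous substitution of terms for the individual variables of a proof term. -/
def isubst : Proof L → (ℕ → L.Term ℕ) → Proof L
  | var n, _ => var n
  | unit, _ => unit
  | pair p q, σ => pair (p.isubst σ) (q.isubst σ)
  | fst p, σ => fst (p.isubst σ)
  | snd p, σ => snd (p.isubst σ)
  | inl B p, σ => inl (B.subst σ) (p.isubst σ)
  | inr A p, σ => inr (A.subst σ) (p.isubst σ)
  | orE q r s, σ => orE (q.isubst σ) (r.isubst σ) (s.isubst σ)
  | lam A p, σ => lam (A.subst σ) (p.isubst σ)
  | app p q, σ => app (p.isubst σ) (q.isubst σ)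
  | allI p, σ => allI (p.isubst (iUp σ))
  | allE p a, σ => allE (p.isubst σ) (a.subst σ)
  | exI A a p, σ => exI (A.subst (iUp σ)) (a.subst σ) (p.isubst σ)
  | exE q r, σ => exE (q.isubst σ) (r.isubst (iUp σ))

/-- The renaming of proof variables that acts like `ρ` below one binder of a proof variable. -/
def rUp (ρ : ℕ → ℕ) : ℕ → ℕ
  | 0 => 0
  | n + 1 => ρ n + 1

/-- Renaming of proof variables. -/
def rename : Proof L → (ℕ → ℕ) → Proof L
  | var n, ρ => var (ρ n)
  | unit, _ => unit
  | pair p q, ρ => pair (p.rename ρ) (q.rename ρ)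
  | fst p, ρ => fst (p.rename ρ)
  | snd p, ρ => snd (p.rename ρ)
  | inl B p, ρ => inl B (p.rename ρ)
  | inr A p, ρ => inr A (p.rename ρ)
  | orE q r s, ρ => orE (q.rename ρ) (r.rename (rUp ρ)) (s.rename (rUp ρ))
  | lam A p, ρ => lam A (p.rename (rUp ρ))
  | app p q, ρ => app (p.rename ρ) (q.rename ρ)
  | allI p, ρ => allI (p.rename ρ)
  | allE p a, ρ => allE (p.rename ρ) a
  | exI A a p, ρ => exI A a (p.rename ρ)
  | exE q r, ρ => exE (q.rename ρ) (r.rename (rUp ρ))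

/-- Weakening by one more proof variable. -/
def shift (p : Proof L) : Proof L := p.rename Nat.succ

/-- Weakening by one more individual variable. -/
def ishift (p : Proof L) : Proof L := p.isubst iShift

/-- The substitution that acts like `τ` below one binder of a proof variable. -/
def up (τ : ℕ → Proof L) : ℕ → Proof L
  | 0 => var 0
  | n + 1 => (τ n).shift

/-- Capture-avoiding simultaneous substitution of proof terms for the proof variables. -/
def subst : Proof L → (ℕ → Proof L) → Proof L
  | var n, τ => τ n
  | unit, _ => unit
  | pair p q, τ => pair (p.subst τ) (q.subst τ)
  | fst p, τ => fst (p.subst τ)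
  | snd p, τ => snd (p.subst τ)
  | inl B p, τ => inl B (p.subst τ)
  | inr A p, τ => inr A (p.subst τ)
  | orE q r s, τ => orE (q.subst τ) (r.subst (up τ)) (s.subst (up τ))
  | lam A p, τ => lam A (p.subst (up τ))
  | app p q, τ => app (p.subst τ) (q.subst τ)
  | allI p, τ => allI (p.subst (fun n => (τ n).ishift))
  | allE p a, τ => allE (p.subst τ) a
  | exI A a p, τ => exI A a (p.subst τ)
  | exE q r, τ => exE (q.subst τ) (r.subst (up (fun n => (τ n).ishift)))

/-- `p{q/a}`, where `a` is the proof variable `0`, which is removed. -/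
def inst (p q : Proof L) : Proof L :=
  p.subst (fun n => match n with
    | 0 => q
    | n + 1 => var n)

/-- `p{q/a}`, where `a` is the proof variable `0` and the new proof variable `0` may occur in `q`;
the other proof variables stay in place. -/
def replace (p q : Proof L) : Proof L :=
  p.subst (fun n => match n with
    | 0 => q
    | n + 1 => var (n + 1))

end Proof

/-- `HasType Γ p A`: the term `p` is a natural deduction proof of `A` from the hypotheses `Γ`, of
which the `n`-th is the type of the proof variable `n`. -/
inductive HasType {L : FirstOrder.Language.{u, v}} : List (Formula L) → Proof L → Formula L → Prop
  | var {Γ n A} : Γ[n]? = some A → HasType Γ (.var n) A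
  | unit {Γ} : HasType Γ .unit .top
  | pair {Γ p q A B} : HasType Γ p A → HasType Γ q B → HasType Γ (.pair p q) (.and A B)
  | fst {Γ p A B} : HasType Γ p (.and A B) → HasType Γ (.fst p) A
  | snd {Γ p A B} : HasType Γ p (.and A B) → HasType Γ (.snd p) B
  | inl {Γ p A B} : HasType Γ p A → HasType Γ (.inl B p) (.or A B)
  | inr {Γ p A B} : HasType Γ p B → HasType Γ (.inr A p) (.or A B)
  | orE {Γ q r s A B C} : HasType Γ q (.or A B) → HasType (A :: Γ) r C → HasType (B :: Γ) s C →
      HasType Γ (.orE q r s) C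
  | lam {Γ p A B} : HasType (A :: Γ) p B → HasType Γ (.lam A p) (.imp A B)
  | app {Γ p q A B} : HasType Γ p (.imp A B) → HasType Γ q A → HasType Γ (.app p q) B
  | allI {Γ p A} : HasType (Γ.map Formula.lift) p A → HasType Γ (.allI p) (.all A)
  | allE {Γ p A} (a : L.Term ℕ) : HasType Γ p (.all A) → HasType Γ (.allE p a) (A.inst a)
  | exI {Γ p A} (a : L.Term ℕ) : HasType Γ p (A.inst a) → HasType Γ (.exI A a p) (.ex A)
  | exE {Γ q r A C} : HasType Γ q (.ex A) → HasType (A :: Γ.map Formula.lift) r C.lift →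
      HasType Γ (.exE q r) C

/-- `Conv Γ p q A`: the proofs `p` and `q` of `A` from `Γ` are beta-eta equal, that is, related by
the least congruence that contains the beta and eta equations of all connectives. -/
inductive Conv {L : FirstOrder.Language.{u, v}} :
    List (Formula L) → Proof L → Proof L → Formula L → Prop
  -- equivalence relation
  | refl {Γ p A} : HasType Γ p A → Conv Γ p p A
  | symm {Γ p q A} : Conv Γ p q A → Conv Γ q p A
  | trans {Γ p q r A} : Conv Γ p q A → Conv Γ q r A → Conv Γ p r A
  -- congruence rules
  | pair {Γ p p' q q' A B} : Conv Γ p p' A → Conv Γ q q' B →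
      Conv Γ (.pair p q) (.pair p' q') (.and A B)
  | fst {Γ p p' A B} : Conv Γ p p' (.and A B) → Conv Γ (.fst p) (.fst p') A
  | snd {Γ p p' A B} : Conv Γ p p' (.and A B) → Conv Γ (.snd p) (.snd p') B
  | inl {Γ p p' A B} : Conv Γ p p' A → Conv Γ (.inl B p) (.inl B p') (.or A B)
  | inr {Γ p p' A B} : Conv Γ p p' B → Conv Γ (.inr A p) (.inr A p') (.or A B)
  | orE {Γ q q' r r' s s' A B C} : Conv Γ q q' (.or A B) → Conv (A :: Γ) r r' C →
      Conv (B :: Γ) s s' C → Conv Γ (.orE q r s) (.orE q' r' s') C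
  | lam {Γ p p' A B} : Conv (A :: Γ) p p' B → Conv Γ (.lam A p) (.lam A p') (.imp A B)
  | app {Γ p p' q q' A B} : Conv Γ p p' (.imp A B) → Conv Γ q q' A →
      Conv Γ (.app p q) (.app p' q') B
  | allI {Γ p p' A} : Conv (Γ.map Formula.lift) p p' A → Conv Γ (.allI p) (.allI p') (.all A)
  | allE {Γ p p' A} (a : L.Term ℕ) : Conv Γ p p' (.all A) →
      Conv Γ (.allE p a) (.allE p' a) (A.inst a)
  | exI {Γ p p' A} (a : L.Term ℕ) : Conv Γ p p' (A.inst a) →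
      Conv Γ (.exI A a p) (.exI A a p') (.ex A)
  | exE {Γ q q' r r' A C} : Conv Γ q q' (.ex A) →
      Conv (A :: Γ.map Formula.lift) r r' C.lift → Conv Γ (.exE q r) (.exE q' r') C
  -- beta rules
  | beta_fst {Γ p q A B} : HasType Γ p A → HasType Γ q B → Conv Γ (.fst (.pair p q)) p A
  | beta_snd {Γ p q A B} : HasType Γ p A → HasType Γ q B → Conv Γ (.snd (.pair p q)) q B
  | beta_inl {Γ p r s A B C} : HasType Γ p A → HasType (A :: Γ) r C → HasType (B :: Γ) s C →
      Conv Γ (.orE (.inl B p) r s) (r.inst p) C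
  | beta_inr {Γ p r s A B C} : HasType Γ p B → HasType (A :: Γ) r C → HasType (B :: Γ) s C →
      Conv Γ (.orE (.inr A p) r s) (s.inst p) C
  | beta_imp {Γ p q A B} : HasType (A :: Γ) p B → HasType Γ q A →
      Conv Γ (.app (.lam A p) q) (p.inst q) B
  | beta_all {Γ p A} (a : L.Term ℕ) : HasType (Γ.map Formula.lift) p A →
      Conv Γ (.allE (.allI p) a) (p.isubst (iInst a)) (A.inst a)
  | beta_ex {Γ p r A C} (a : L.Term ℕ) : HasType Γ p (A.inst a) →
      HasType (A :: Γ.map Formula.lift) r C.lift →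
      Conv Γ (.exE (.exI A a p) r) ((r.isubst (iInst a)).inst p) C
  -- eta rules
  | eta_top {Γ p} : HasType Γ p .top → Conv Γ p .unit .top
  | eta_and {Γ p A B} : HasType Γ p (.and A B) → Conv Γ p (.pair (.fst p) (.snd p)) (.and A B)
  | eta_or {Γ p q A B C} : HasType (.or A B :: Γ) p C → HasType Γ q (.or A B) →
      Conv Γ (p.inst q)
        (.orE q (p.replace (.inl B (.var 0))) (p.replace (.inr A (.var 0)))) C
  | eta_imp {Γ p A B} : HasType Γ p (.imp A B) →
      Conv Γ p (.lam A (.app p.shift (.var 0))) (.imp A B)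
  | eta_all {Γ p A} : HasType Γ p (.all A) →
      Conv Γ p (.allI (.allE p.ishift (FirstOrder.Language.Term.var 0))) (.all A)
  | eta_ex {Γ p q A C} : HasType (.ex A :: Γ) p C → HasType Γ q (.ex A) →
      Conv Γ (p.inst q)
        (.exE q (p.ishift.replace
          (.exI (A.subst (iUp iShift)) (FirstOrder.Language.Term.var 0) (.var 0)))) C

/-- Isomorphism of formulas: there are closed proofs `φ` of `F → G` and `ψ` of `G → F` with
`λ a. ψ (φ a) = λ a. a` and `λ c. φ (ψ c) = λ c. c` up to beta-eta equality. -/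
def Iso {L : FirstOrder.Language.{u, v}} (F G : Formula L) : Prop :=
  ∃ φ ψ : Proof L,
    HasType [] φ (.imp F G) ∧ HasType [] ψ (.imp G F) ∧
    Conv [] (.lam F (.app ψ.shift (.app φ.shift (.var 0)))) (.lam F (.var 0)) (.imp F F) ∧
    Conv [] (.lam G (.app φ.shift (.app ψ.shift (.var 0)))) (.lam G (.var 0)) (.imp G G)

/-! ### The classes -/

mutual

/-- `Σ`: the disjunctions `c₁ ∨ ⋯ ∨ cₙ`, `n ≥ 2`, of formulas `cᵢ` in `Π`. -/
inductive IsSigma {L : FirstOrder.Language.{u, v}} : Formula L → Prop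
  | disj (c : Formula L) (l : List (Formula L)) (hl : l ≠ []) (hc : IsPi c)
      (h : ∀ c' ∈ l, IsPi c') : IsSigma (Formula.disj c l)

/-- `Π`: the conjunctions `∀ x⃗₁ (c₁ → b₁) ∧ ⋯ ∧ ∀ x⃗ₙ (cₙ → bₙ)`, `n ≥ 0`, with `cᵢ` in `Π` and
bases `bᵢ`; the entry `(k, c, b)` of `l` stands for `∀ x₁ … ∀ xₖ (c → b)`, and `k = 0` is
allowed. -/
inductive IsPi {L : FirstOrder.Language.{u, v}} : Formula L → Prop
  | conj (l : List (ℕ × Formula L × Formula L)) (hc : ∀ t ∈ l, IsPi t.2.1)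
      (hb : ∀ t ∈ l, IsBase t.2.2) :
      IsPi (Formula.conj (l.map fun t => Formula.alls t.1 (Formula.imp t.2.1 t.2.2)))

/-- The bases: atoms, formulas in `Σ`, and `∃ x₁ … ∃ xₖ c` with `k ≥ 1` and `c` in `Π`. -/
inductive IsBase {L : FirstOrder.Language.{u, v}} : Formula L → Prop
  | atom {k : ℕ} (R : L.Relations k) (ts : Fin k → L.Term ℕ) : IsBase (Formula.rel R ts)
  | sigma (d : Formula L) (hd : IsSigma d) : IsBase d
  | ex (k : ℕ) (hk : 1 ≤ k) (c : Formula L) (hc : IsPi c) : IsBase (Formula.exs k c)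

end

end IntHierarchy

namespace IntHierarchy

universe u v

variable {L : FirstOrder.Language.{u, v}}

/-! ### Substitution of individual variables -/

theorem term_subst_var (t : L.Term ℕ) : t.subst FirstOrder.Language.Term.var = t := by
  induction t with
  | var n => rfl
  | func f ts ih => simp only [FirstOrder.Language.Term.subst, ih]

theorem term_subst_subst (t : L.Term ℕ) (σ σ' : ℕ → L.Term ℕ) :
    (t.subst σ).subst σ' = t.subst (fun n => (σ n).subst σ') := by
  induction t with
  | var n => rfl
  | func f ts ih => simp only [FirstOrder.Language.Term.subst, ih]

theorem term_relabel_eq_subst (t : L.Term ℕ) (g : ℕ → ℕ) :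
    t.relabel g = t.subst (fun n => FirstOrder.Language.Term.var (g n)) := by
  induction t with
  | var n => rfl
  | func f ts ih => simp only [FirstOrder.Language.Term.subst, FirstOrder.Language.Term.relabel, ih]

theorem iUp_var : iUp (FirstOrder.Language.Term.var : ℕ → L.Term ℕ) = FirstOrder.Language.Term.var := by
  funext n
  cases n <;> rfl

theorem iUp_comp (σ σ' : ℕ → L.Term ℕ) :
    (fun n => (iUp σ n).subst (iUp σ')) = iUp (fun n => (σ n).subst σ') := by
  funext n
  cases n with
  | zero => rfl
  | succ n =>
    simp only [iUp, term_relabel_eq_subst, term_subst_subst]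
    simp only [FirstOrder.Language.Term.subst, iUp, Nat.succ_eq_add_one, term_relabel_eq_subst]

theorem iShift_iUp (σ : ℕ → L.Term ℕ) :
    (fun n => (iShift n : L.Term ℕ).subst (iUp σ)) = fun n => (σ n).subst iShift := by
  funext n
  simp only [iShift, FirstOrder.Language.Term.subst, iUp, term_relabel_eq_subst]
  rfl

theorem iInst_comp (a : L.Term ℕ) (σ : ℕ → L.Term ℕ) :
    (fun n => (iInst a n).subst σ) = fun n => (iUp σ n).subst (iInst (a.subst σ)) := by
  funext n
  cases n with
  | zero => rfl
  | succ n =>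
    simp only [iInst, iUp, term_relabel_eq_subst, term_subst_subst]
    exact (term_subst_var _).symm

theorem iUp_iShift_iInst :
    (fun n => (iUp iShift n : L.Term ℕ).subst (iInst (FirstOrder.Language.Term.var 0))) =
      FirstOrder.Language.Term.var := by
  funext n
  cases n <;> rfl

namespace Formula

theorem subst_var (A : Formula L) : A.subst FirstOrder.Language.Term.var = A := by
  induction A <;> simp_all [subst, term_subst_var, iUp_var]

theorem subst_subst (A : Formula L) (σ σ' : ℕ → L.Term ℕ) :
    (A.subst σ).subst σ' = A.subst (fun n => (σ n).subst σ') := by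
  induction A generalizing σ σ' <;> simp_all [subst, term_subst_subst, iUp_comp]

theorem lift_subst (A : Formula L) (σ : ℕ → L.Term ℕ) :
    A.lift.subst (iUp σ) = (A.subst σ).lift := by
  simp only [lift, subst_subst, iShift_iUp]

theorem inst_subst (A : Formula L) (a : L.Term ℕ) (σ : ℕ → L.Term ℕ) :
    (A.inst a).subst σ = (A.subst (iUp σ)).inst (a.subst σ) := by
  simp only [inst, subst_subst, iInst_comp]

theorem inst_iUp_iShift (A : Formula L) :
    (A.subst (iUp iShift)).inst (FirstOrder.Language.Term.var 0) = A := by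
  simp only [inst, subst_subst, iUp_iShift_iInst, subst_var]

theorem map_lift_map_subst (Γ : List (Formula L)) (σ : ℕ → L.Term ℕ) :
    (Γ.map lift).map (fun A => A.subst (iUp σ)) = (Γ.map (fun A => A.subst σ)).map lift := by
  simp only [List.map_map]
  exact List.map_congr_left fun A _ => lift_subst A σ

end Formula

/-! ### Substitution in proof terms -/

namespace Proof

theorem isubst_var (p : Proof L) : p.isubst FirstOrder.Language.Term.var = p := by
  induction p <;> simp_all [isubst, term_subst_var, Formula.subst_var, iUp_var]

theorem isubst_isubst (p : Proof L) (σ σ' : ℕ → L.Term ℕ) :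
    (p.isubst σ).isubst σ' = p.isubst (fun n => (σ n).subst σ') := by
  induction p generalizing σ σ' <;>
    simp_all [isubst, term_subst_subst, Formula.subst_subst, iUp_comp]

theorem ishift_isubst (p : Proof L) (σ : ℕ → L.Term ℕ) :
    p.ishift.isubst (iUp σ) = (p.isubst σ).ishift := by
  simp only [ishift, isubst_isubst, iShift_iUp]

theorem isubst_iUp_iShift_iInst (p : Proof L) :
    (p.isubst (iUp iShift)).isubst (iInst (FirstOrder.Language.Term.var 0)) = p := by
  simp only [isubst_isubst, iUp_iShift_iInst, isubst_var]

theorem rename_isubst (p : Proof L) (ρ : ℕ → ℕ) (σ : ℕ → L.Term ℕ) :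
    (p.rename ρ).isubst σ = (p.isubst σ).rename ρ := by
  induction p generalizing ρ σ <;> simp_all [isubst, rename]

theorem shift_isubst (p : Proof L) (σ : ℕ → L.Term ℕ) :
    p.shift.isubst σ = (p.isubst σ).shift := rename_isubst ..

theorem rUp_comp (ρ ρ' : ℕ → ℕ) : (fun n => rUp ρ' (rUp ρ n)) = rUp (fun n => ρ' (ρ n)) := by
  funext n
  cases n <;> rfl

theorem rename_rename (p : Proof L) (ρ ρ' : ℕ → ℕ) :
    (p.rename ρ).rename ρ' = p.rename (fun n => ρ' (ρ n)) := by
  induction p generalizing ρ ρ' <;> simp_all [rename, rUp_comp]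

theorem shift_rename (p : Proof L) (ρ : ℕ → ℕ) :
    p.shift.rename (rUp ρ) = (p.rename ρ).shift := by
  simp only [shift, rename_rename]
  rfl

theorem up_rUp (ρ : ℕ → ℕ) (τ : ℕ → Proof L) :
    (fun n => up τ (rUp ρ n)) = up (fun n => τ (ρ n)) := by
  funext n
  cases n <;> rfl

theorem rename_subst (p : Proof L) (ρ : ℕ → ℕ) (τ : ℕ → Proof L) :
    (p.rename ρ).subst τ = p.subst (fun n => τ (ρ n)) := by
  induction p generalizing ρ τ <;> simp_all [rename, subst, up_rUp]

theorem up_rename (ρ : ℕ → ℕ) (τ : ℕ → Proof L) :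
    (fun n => (up τ n).rename (rUp ρ)) = up (fun n => (τ n).rename ρ) := by
  funext n
  cases n with
  | zero => rfl
  | succ n => exact shift_rename _ _

theorem ishift_rename (p : Proof L) (ρ : ℕ → ℕ) :
    (p.rename ρ).ishift = p.ishift.rename ρ := rename_isubst ..

theorem subst_rename (p : Proof L) (τ : ℕ → Proof L) (ρ : ℕ → ℕ) :
    (p.subst τ).rename ρ = p.subst (fun n => (τ n).rename ρ) := by
  induction p generalizing ρ τ <;>
    simp_all [rename, subst, up_rename, ishift_rename]

theorem up_isubst (τ : ℕ → Proof L) (σ : ℕ → L.Term ℕ) :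
    (fun n => (up τ n).isubst σ) = up (fun n => (τ n).isubst σ) := by
  funext n
  cases n with
  | zero => rfl
  | succ n => exact shift_isubst _ _

theorem subst_isubst (p : Proof L) (τ : ℕ → Proof L) (σ : ℕ → L.Term ℕ) :
    (p.subst τ).isubst σ = (p.isubst σ).subst (fun n => (τ n).isubst σ) := by
  induction p generalizing τ σ <;>
    simp_all [isubst, subst, up_isubst, ishift_isubst]

theorem subst_ishift (p : Proof L) (τ : ℕ → Proof L) :
    (p.subst τ).ishift = p.ishift.subst (fun n => (τ n).ishift) := subst_isubst ..

theorem shift_subst_up (p : Proof L) (τ : ℕ → Proof L) :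
    p.shift.subst (up τ) = (p.subst τ).shift := by
  simp only [shift, rename_subst, subst_rename]
  rfl

theorem up_subst (τ τ' : ℕ → Proof L) :
    (fun n => (up τ n).subst (up τ')) = up (fun n => (τ n).subst τ') := by
  funext n
  cases n with
  | zero => rfl
  | succ n => exact shift_subst_up _ _

theorem subst_subst (p : Proof L) (τ τ' : ℕ → Proof L) :
    (p.subst τ).subst τ' = p.subst (fun n => (τ n).subst τ') := by
  induction p generalizing τ τ' <;> simp_all [subst, up_subst, subst_ishift]

theorem inst_isubst (p q : Proof L) (σ : ℕ → L.Term ℕ) :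
    (p.inst q).isubst σ = (p.isubst σ).inst (q.isubst σ) := by
  simp only [inst, subst_isubst]
  congr 1
  funext n
  cases n <;> rfl

theorem replace_isubst (p q : Proof L) (σ : ℕ → L.Term ℕ) :
    (p.replace q).isubst σ = (p.isubst σ).replace (q.isubst σ) := by
  simp only [replace, subst_isubst]
  congr 1
  funext n
  cases n <;> rfl

theorem isubst_iInst_isubst (p : Proof L) (a : L.Term ℕ) (σ : ℕ → L.Term ℕ) :
    (p.isubst (iInst a)).isubst σ = (p.isubst (iUp σ)).isubst (iInst (a.subst σ)) := by
  simp only [isubst_isubst, iInst_comp]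

end Proof

/-! ### Typing -/

namespace HasType

open Proof

theorem append {Γ : List (Formula L)} {p A} (h : HasType Γ p A) (Δ : List (Formula L)) :
    HasType (Γ ++ Δ) p A := by
  induction h generalizing Δ with
  | var h =>
    refine .var ?_
    rw [List.getElem?_append_left (List.getElem?_eq_some_iff.1 h).1, h]
  | unit => exact .unit
  | pair _ _ h₁ h₂ => exact .pair (h₁ Δ) (h₂ Δ)
  | fst _ h => exact .fst (h Δ)
  | snd _ h => exact .snd (h Δ)
  | inl _ h => exact .inl (h Δ)
  | inr _ h => exact .inr (h Δ)
  | orE _ _ _ h₁ h₂ h₃ => exact .orE (h₁ Δ) (h₂ Δ) (h₃ Δ)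
  | lam _ h => exact .lam (h Δ)
  | app _ _ h₁ h₂ => exact .app (h₁ Δ) (h₂ Δ)
  | allI _ h => exact .allI (by simpa only [List.map_append] using h (Δ.map Formula.lift))
  | allE a _ h => exact .allE a (h Δ)
  | exI a _ h => exact .exI a (h Δ)
  | exE _ _ h₁ h₂ => exact .exE (h₁ Δ) (by
      simpa only [List.map_append, List.cons_append] using h₂ (Δ.map Formula.lift))

theorem isubst {Γ : List (Formula L)} {p A} (h : HasType Γ p A) (σ : ℕ → L.Term ℕ) :
    HasType (Γ.map (fun B => B.subst σ)) (p.isubst σ) (A.subst σ) := by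
  induction h generalizing σ with
  | var h => exact .var (by simp [h])
  | unit => exact .unit
  | pair _ _ h₁ h₂ => exact .pair (h₁ σ) (h₂ σ)
  | fst _ h => exact .fst (h σ)
  | snd _ h => exact .snd (h σ)
  | inl _ h => exact .inl (h σ)
  | inr _ h => exact .inr (h σ)
  | orE _ _ _ h₁ h₂ h₃ => exact .orE (h₁ σ) (h₂ σ) (h₃ σ)
  | lam _ h => exact .lam (h σ)
  | app _ _ h₁ h₂ => exact .app (h₁ σ) (h₂ σ)
  | allI _ h => exact .allI (by simpa only [Formula.map_lift_map_subst] using h (iUp σ))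
  | allE a _ h =>
    rw [Formula.inst_subst]
    exact .allE _ (h σ)
  | exI a _ h => exact .exI _ (by simpa only [Formula.inst_subst] using h σ)
  | exE _ _ h₁ h₂ =>
    refine .exE (h₁ σ) ?_
    simpa only [List.map_cons, Formula.map_lift_map_subst, Formula.lift_subst] using h₂ (iUp σ)

theorem ishift {Γ : List (Formula L)} {p A} (h : HasType Γ p A) :
    HasType (Γ.map Formula.lift) p.ishift A.lift := h.isubst iShift

theorem rename {Γ Δ : List (Formula L)} {p A} (h : HasType Γ p A) (ρ : ℕ → ℕ)
    (hρ : ∀ n B, Γ[n]? = some B → Δ[ρ n]? = some B) : HasType Δ (p.rename ρ) A := by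
  have up : ∀ {Γ Δ : List (Formula L)} {ρ : ℕ → ℕ} (C : Formula L),
      (∀ n B, Γ[n]? = some B → Δ[ρ n]? = some B) →
      ∀ n B, (C :: Γ)[n]? = some B → (C :: Δ)[rUp ρ n]? = some B := by
    intro Γ Δ ρ C h n B hn
    cases n with
    | zero => simpa [rUp] using hn
    | succ n => simpa [rUp] using h n B (by simpa using hn)
  have lift : ∀ {Γ Δ : List (Formula L)} {ρ : ℕ → ℕ},
      (∀ n B, Γ[n]? = some B → Δ[ρ n]? = some B) →
      ∀ n B, (Γ.map Formula.lift)[n]? = some B → (Δ.map Formula.lift)[ρ n]? = some B := by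
    intro Γ Δ ρ h n B hn
    simp only [List.getElem?_map, Option.map_eq_some_iff] at hn ⊢
    obtain ⟨C, hC, rfl⟩ := hn
    exact ⟨C, h n C hC, rfl⟩
  induction h generalizing Δ ρ with
  | var h => exact .var (hρ _ _ h)
  | unit => exact .unit
  | pair _ _ h₁ h₂ => exact .pair (h₁ ρ hρ) (h₂ ρ hρ)
  | fst _ h => exact .fst (h ρ hρ)
  | snd _ h => exact .snd (h ρ hρ)
  | inl _ h => exact .inl (h ρ hρ)
  | inr _ h => exact .inr (h ρ hρ)
  | orE _ _ _ h₁ h₂ h₃ => exact .orE (h₁ ρ hρ) (h₂ _ (up _ hρ)) (h₃ _ (up _ hρ))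
  | lam _ h => exact .lam (h _ (up _ hρ))
  | app _ _ h₁ h₂ => exact .app (h₁ ρ hρ) (h₂ ρ hρ)
  | allI _ h => exact .allI (h ρ (lift hρ))
  | allE a _ h => exact .allE a (h ρ hρ)
  | exI a _ h => exact .exI a (h ρ hρ)
  | exE _ _ h₁ h₂ => exact .exE (h₁ ρ hρ) (h₂ _ (up _ (lift hρ)))

theorem shift {Γ : List (Formula L)} {p A} (h : HasType Γ p A) (B : Formula L) :
    HasType (B :: Γ) p.shift A :=
  h.rename _ fun n C hn => by simpa using hn

theorem subst {Γ Δ : List (Formula L)} {p A} (h : HasType Γ p A) (τ : ℕ → Proof L)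
    (hτ : ∀ n B, Γ[n]? = some B → HasType Δ (τ n) B) : HasType Δ (p.subst τ) A := by
  have hup : ∀ {Γ Δ : List (Formula L)} {τ : ℕ → Proof L} (C : Formula L),
      (∀ n B, Γ[n]? = some B → HasType Δ (τ n) B) →
      ∀ n B, (C :: Γ)[n]? = some B → HasType (C :: Δ) (up τ n) B := by
    intro Γ Δ τ C h n B hn
    cases n with
    | zero => exact .var (by simpa using hn)
    | succ n => exact (h n B (by simpa using hn)).shift C
  have lift : ∀ {Γ Δ : List (Formula L)} {τ : ℕ → Proof L},
      (∀ n B, Γ[n]? = some B → HasType Δ (τ n) B) →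
      ∀ n B, (Γ.map Formula.lift)[n]? = some B →
        HasType (Δ.map Formula.lift) (τ n).ishift B := by
    intro Γ Δ τ h n B hn
    simp only [List.getElem?_map, Option.map_eq_some_iff] at hn
    obtain ⟨C, hC, rfl⟩ := hn
    exact (h n C hC).ishift
  induction h generalizing Δ τ with
  | var h => exact hτ _ _ h
  | unit => exact .unit
  | pair _ _ h₁ h₂ => exact .pair (h₁ τ hτ) (h₂ τ hτ)
  | fst _ h => exact .fst (h τ hτ)
  | snd _ h => exact .snd (h τ hτ)
  | inl _ h => exact .inl (h τ hτ)
  | inr _ h => exact .inr (h τ hτ)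
  | orE _ _ _ h₁ h₂ h₃ => exact .orE (h₁ τ hτ) (h₂ _ (hup _ hτ)) (h₃ _ (hup _ hτ))
  | lam _ h => exact .lam (h _ (hup _ hτ))
  | app _ _ h₁ h₂ => exact .app (h₁ τ hτ) (h₂ τ hτ)
  | allI _ h => exact .allI (h _ (lift hτ))
  | allE a _ h => exact .allE a (h τ hτ)
  | exI a _ h => exact .exI a (h τ hτ)
  | exE _ _ h₁ h₂ => exact .exE (h₁ τ hτ) (h₂ _ (hup _ (lift hτ)))

/-- Only the values at the hypotheses matter for a substitution. -/
theorem subst_congr {Γ : List (Formula L)} {p A} (h : HasType Γ p A) {τ τ' : ℕ → Proof L}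
    (hτ : ∀ n < Γ.length, τ n = τ' n) : p.subst τ = p.subst τ' := by
  have hup : ∀ {m : ℕ} {τ τ' : ℕ → Proof L}, (∀ n < m, τ n = τ' n) →
      ∀ n < m + 1, up τ n = up τ' n := by
    intro m τ τ' h n hn
    cases n with
    | zero => rfl
    | succ n => simp only [up, h n (by omega)]
  induction h generalizing τ τ' with
  | var h => exact hτ _ (List.getElem?_eq_some_iff.1 h).1
  | unit => rfl
  | pair _ _ h₁ h₂ => simp only [Proof.subst, h₁ hτ, h₂ hτ]
  | fst _ h => simp only [Proof.subst, h hτ]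
  | snd _ h => simp only [Proof.subst, h hτ]
  | inl _ h => simp only [Proof.subst, h hτ]
  | inr _ h => simp only [Proof.subst, h hτ]
  | orE _ _ _ h₁ h₂ h₃ => simp only [Proof.subst, h₁ hτ, h₂ (hup hτ), h₃ (hup hτ)]
  | lam _ h => simp only [Proof.subst, h (hup hτ)]
  | app _ _ h₁ h₂ => simp only [Proof.subst, h₁ hτ, h₂ hτ]
  | allI _ h =>
    have := @h (fun n => (τ n).ishift) (fun n => (τ' n).ishift)
      fun n hn => by rw [hτ n (by simpa using hn)]
    simp only [Proof.subst, this]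
  | allE a _ h => simp only [Proof.subst, h hτ]
  | exI a _ h => simp only [Proof.subst, h hτ]
  | exE _ _ h₁ h₂ =>
    have := @h₂ (up fun n => (τ n).ishift) (up fun n => (τ' n).ishift)
      (hup fun n hn => by rw [hτ n (by simpa using hn)])
    simp only [Proof.subst, h₁ hτ, this]

end HasType

namespace Proof

theorem up_var : up (var : ℕ → Proof L) = var := by
  funext n
  cases n <;> rfl

theorem subst_var (p : Proof L) : p.subst var = p := by
  induction p <;> simp_all [subst, up_var, ishift, isubst]

theorem rename_eq_subst (p : Proof L) (ρ : ℕ → ℕ) : p.rename ρ = p.subst (fun n => var (ρ n)) := by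
  rw [← rename_subst, subst_var]

end Proof

/-! ### Conversion -/

namespace Conv

open Proof

theorem append {Γ : List (Formula L)} {p q A} (h : Conv Γ p q A) (Δ : List (Formula L)) :
    Conv (Γ ++ Δ) p q A := by
  induction h generalizing Δ with
  | refl h => exact .refl (h.append Δ)
  | symm _ h => exact .symm (h Δ)
  | trans _ _ h₁ h₂ => exact .trans (h₁ Δ) (h₂ Δ)
  | pair _ _ h₁ h₂ => exact .pair (h₁ Δ) (h₂ Δ)
  | fst _ h => exact .fst (h Δ)
  | snd _ h => exact .snd (h Δ)
  | inl _ h => exact .inl (h Δ)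
  | inr _ h => exact .inr (h Δ)
  | orE _ _ _ h₁ h₂ h₃ => exact .orE (h₁ Δ) (h₂ Δ) (h₃ Δ)
  | lam _ h => exact .lam (h Δ)
  | app _ _ h₁ h₂ => exact .app (h₁ Δ) (h₂ Δ)
  | allI _ h => exact .allI (by simpa only [List.map_append] using h (Δ.map Formula.lift))
  | allE a _ h => exact .allE a (h Δ)
  | exI a _ h => exact .exI a (h Δ)
  | exE _ _ h₁ h₂ => exact .exE (h₁ Δ) (by
      simpa only [List.map_append, List.cons_append] using h₂ (Δ.map Formula.lift))
  | beta_fst h₁ h₂ => exact .beta_fst (h₁.append Δ) (h₂.append Δ)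
  | beta_snd h₁ h₂ => exact .beta_snd (h₁.append Δ) (h₂.append Δ)
  | beta_inl h₁ h₂ h₃ => exact .beta_inl (h₁.append Δ) (h₂.append Δ) (h₃.append Δ)
  | beta_inr h₁ h₂ h₃ => exact .beta_inr (h₁.append Δ) (h₂.append Δ) (h₃.append Δ)
  | beta_imp h₁ h₂ => exact .beta_imp (h₁.append Δ) (h₂.append Δ)
  | beta_all a h =>
    have := h.append (Δ.map Formula.lift)
    exact .beta_all a (by simpa using this)
  | beta_ex a h₁ h₂ =>
    have := h₂.append (Δ.map Formula.lift)
    exact .beta_ex a (h₁.append Δ) (by simpa using this)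
  | eta_top h => exact .eta_top (h.append Δ)
  | eta_and h => exact .eta_and (h.append Δ)
  | eta_or h₁ h₂ => exact .eta_or (h₁.append Δ) (h₂.append Δ)
  | eta_imp h => exact .eta_imp (h.append Δ)
  | eta_all h => exact .eta_all (h.append Δ)
  | eta_ex h₁ h₂ => exact .eta_ex (h₁.append Δ) (h₂.append Δ)

theorem isubst {Γ : List (Formula L)} {p q A} (h : Conv Γ p q A) (σ : ℕ → L.Term ℕ) :
    Conv (Γ.map (fun B => B.subst σ)) (p.isubst σ) (q.isubst σ) (A.subst σ) := by
  induction h generalizing σ with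
  | refl h => exact .refl (h.isubst σ)
  | symm _ h => exact .symm (h σ)
  | trans _ _ h₁ h₂ => exact .trans (h₁ σ) (h₂ σ)
  | pair _ _ h₁ h₂ => exact .pair (h₁ σ) (h₂ σ)
  | fst _ h => exact .fst (h σ)
  | snd _ h => exact .snd (h σ)
  | inl _ h => exact .inl (h σ)
  | inr _ h => exact .inr (h σ)
  | orE _ _ _ h₁ h₂ h₃ => exact .orE (h₁ σ) (h₂ σ) (h₃ σ)
  | lam _ h => exact .lam (h σ)
  | app _ _ h₁ h₂ => exact .app (h₁ σ) (h₂ σ)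
  | allI _ h => exact .allI (by simpa only [Formula.map_lift_map_subst] using h (iUp σ))
  | allE a _ h =>
    rw [Formula.inst_subst]
    exact .allE _ (h σ)
  | exI a _ h => exact .exI _ (by simpa only [Formula.inst_subst] using h σ)
  | exE _ _ h₁ h₂ =>
    refine .exE (h₁ σ) ?_
    simpa only [List.map_cons, Formula.map_lift_map_subst, Formula.lift_subst] using h₂ (iUp σ)
  | beta_fst h₁ h₂ => exact .beta_fst (h₁.isubst σ) (h₂.isubst σ)
  | beta_snd h₁ h₂ => exact .beta_snd (h₁.isubst σ) (h₂.isubst σ)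
  | beta_inl h₁ h₂ h₃ =>
    rw [inst_isubst]
    exact .beta_inl (h₁.isubst σ) (h₂.isubst σ) (h₃.isubst σ)
  | beta_inr h₁ h₂ h₃ =>
    rw [inst_isubst]
    exact .beta_inr (h₁.isubst σ) (h₂.isubst σ) (h₃.isubst σ)
  | beta_imp h₁ h₂ =>
    rw [inst_isubst]
    exact .beta_imp (h₁.isubst σ) (h₂.isubst σ)
  | beta_all a h =>
    rw [isubst_iInst_isubst, Formula.inst_subst]
    exact .beta_all _ (by simpa only [Formula.map_lift_map_subst] using h.isubst (iUp σ))
  | beta_ex a h₁ h₂ =>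
    rw [inst_isubst, isubst_iInst_isubst]
    refine .beta_ex _ (by simpa only [Formula.inst_subst] using h₁.isubst σ) ?_
    simpa only [List.map_cons, Formula.map_lift_map_subst, Formula.lift_subst]
      using h₂.isubst (iUp σ)
  | eta_top h => exact .eta_top (h.isubst σ)
  | eta_and h => exact .eta_and (h.isubst σ)
  | eta_or h₁ h₂ =>
    simp only [inst_isubst, Proof.isubst, replace_isubst]
    exact .eta_or (h₁.isubst σ) (h₂.isubst σ)
  | eta_imp h =>
    simp only [Proof.isubst, shift_isubst]
    exact .eta_imp (h.isubst σ)
  | eta_all h =>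
    simp only [Proof.isubst, ishift_isubst]
    exact .eta_all (h.isubst σ)
  | @eta_ex Γ p q A C h₁ h₂ =>
    have := Conv.eta_ex (h₁.isubst σ) (h₂.isubst σ)
    have e : (A.subst (iUp iShift)).subst (iUp (iUp σ)) =
        (A.subst (iUp σ)).subst (iUp iShift) := by
      simp only [Formula.subst_subst, iUp_comp, iShift_iUp]
    simpa only [inst_isubst, Proof.isubst, replace_isubst, ishift_isubst, e,
      FirstOrder.Language.Term.subst, iUp] using this

theorem ishift {Γ : List (Formula L)} {p q A} (h : Conv Γ p q A) :
    Conv (Γ.map Formula.lift) p.ishift q.ishift A.lift := h.isubst iShift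

theorem of_eq {Γ : List (Formula L)} {p q A} (h : HasType Γ p A) (e : p = q) : Conv Γ p q A :=
  e ▸ .refl h

end Conv

/-! ### Terms with one proof variable -/

namespace Proof

/-- The proof `q` is substituted for every proof variable of `p`. -/
def comp (p q : Proof L) : Proof L := p.subst fun _ => q

theorem comp_comp (p q r : Proof L) : (p.comp q).comp r = p.comp (q.comp r) := subst_subst ..

theorem comp_ishift (p q : Proof L) : (p.comp q).ishift = p.ishift.comp q.ishift :=
  subst_ishift ..

end Proof

namespace HasType

open Proof

variable {Γ : List (Formula L)} {A B C : Formula L} {p q : Proof L}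

theorem comp (hp : HasType [A] p B) (hq : HasType Γ q A) : HasType Γ (p.comp q) B :=
  hp.subst _ fun n C h => by
    cases n with
    | zero => obtain rfl : A = C := by simpa using h
              exact hq
    | succ n => simp at h

theorem subst_eq_comp (hp : HasType [A] p B) (τ : ℕ → Proof L) : p.subst τ = p.comp (τ 0) :=
  hp.subst_congr fun n hn => by
    obtain rfl : n = 0 := by simpa using hn
    rfl

theorem inst_eq_comp (hp : HasType [A] p B) : p.inst q = p.comp q := hp.subst_eq_comp _

theorem replace_eq_comp (hp : HasType [A] p B) : p.replace q = p.comp q := hp.subst_eq_comp _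

theorem shift_eq_comp (hp : HasType [A] p B) : p.shift = p.comp (.var 1) := by
  rw [Proof.shift, rename_eq_subst, hp.subst_eq_comp]

theorem comp_var_zero (hp : HasType [A] p B) : p.comp (.var 0) = p := by
  rw [← hp.subst_eq_comp Proof.var, subst_var]

theorem subst_up (hp : HasType [A] p B) (τ : ℕ → Proof L) : p.subst (up τ) = p := by
  rw [hp.subst_eq_comp]
  exact hp.comp_var_zero

end HasType

namespace Conv

open Proof

variable {Γ : List (Formula L)} {A B C : Formula L} {p p' q q' : Proof L}

theorem comp (h : Conv [A] p p' B) (hp : HasType [A] p B) (hp' : HasType [A] p' B)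
    (k : Conv Γ q q' A) (hq : HasType Γ q A) (hq' : HasType Γ q' A) :
    Conv Γ (p.comp q) (p'.comp q') B := by
  have h₁ := Conv.beta_imp (hp.append Γ) hq
  have h₂ := Conv.beta_imp (hp'.append Γ) hq'
  rw [hp.inst_eq_comp] at h₁
  rw [hp'.inst_eq_comp] at h₂
  exact h₁.symm.trans (((h.append Γ).lam.app k).trans h₂)

end Conv

namespace HasType

variable {Γ : List (Formula L)} {A B : Formula L}

theorem var_zero : HasType (A :: Γ) (.var 0) A := .var rfl

theorem var_one : HasType (B :: A :: Γ) (.var 1) A := .var rfl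

end HasType

/-! ### The category of formulas and proofs -/

open CategoryTheory

namespace Formula

/-- Beta-eta equality of the proofs of `B` from the hypothesis `A`. -/
def homSetoid (A B : Formula L) : Setoid {p : Proof L // HasType [A] p B} where
  r p q := Conv [A] p.1 q.1 B
  iseqv := ⟨fun p => .refl p.2, .symm, .trans⟩

instance category : Category.{max u v} (Formula L) where
  Hom A B := Quotient (homSetoid A B)
  id A := Quotient.mk _ ⟨.var 0, .var rfl⟩
  comp := Quotient.map₂ (fun p q => ⟨q.1.comp p.1, q.2.comp p.2⟩)
    fun p p' h q q' k => Conv.comp k q.2 q'.2 h p.2 p'.2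
  id_comp := by
    rintro A B ⟨p⟩
    exact Quotient.sound (Conv.of_eq (p.2.comp (.var rfl)) p.2.comp_var_zero)
  comp_id := by
    rintro A B ⟨p⟩
    exact Quotient.sound (Conv.refl p.2)
  assoc := by
    rintro A B C D ⟨p⟩ ⟨q⟩ ⟨r⟩
    exact Quotient.sound
      (Conv.of_eq (r.2.comp (q.2.comp p.2)) (Proof.comp_comp r.1 q.1 p.1).symm)

variable {A B C D X Y : Formula L}

/-- The morphism given by a proof with one hypothesis. -/
def homMk {p : Proof L} (h : HasType [A] p B) : A ⟶ B := Quotient.mk (homSetoid A B) ⟨p, h⟩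

theorem homMk_exact {p q : Proof L} {hp : HasType [A] p B} {hq : HasType [A] q B}
    (h : homMk hp = homMk hq) : Conv [A] p q B := Quotient.exact h

theorem exists_homMk (f : A ⟶ B) : ∃ (p : Proof L) (h : HasType [A] p B), f = homMk h :=
  Quotient.inductionOn f fun p => ⟨p.1, p.2, rfl⟩

/-- Isomorphic objects are isomorphic formulas. -/
theorem iso_of_iso (i : A ≅ B) : Iso A B := by
  obtain ⟨p, hp, hp'⟩ := exists_homMk i.hom
  obtain ⟨q, hq, hq'⟩ := exists_homMk i.inv
  have key : ∀ {A B : Formula L} {p q : Proof L} (hp : HasType [A] p B) (hq : HasType [B] q A),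
      homMk hp ≫ homMk hq = 𝟙 A →
      Conv [] (.lam A (.app (Proof.lam B q).shift (.app (Proof.lam A p).shift (.var 0))))
        (.lam A (.var 0)) (.imp A A) := by
    intro A B p q hp hq h
    have h0 : HasType [A] (.var 0) A := .var_zero
    have hp2 : HasType [A, A] p B := hp.append [A]
    have hq2 : HasType [B, A] q A := hq.append [A]
    have beta : ∀ {C D : Formula L} {r s : Proof L}, HasType [C] r D → HasType [A] s C →
        Conv [A] (.app (Proof.lam C r).shift s) (r.comp s) D := by
      intro C D r s hr hs
      have e : (Proof.lam C r).shift = .lam C r := by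
        have : r.rename (Proof.rUp Nat.succ) = r := by
          rw [Proof.rename_eq_subst, hr.subst_eq_comp]
          exact hr.comp_var_zero
        simp only [Proof.shift, Proof.rename, this]
      rw [e, ← hr.inst_eq_comp]
      exact .beta_imp (hr.append [A]) hs
    have hp1 : HasType [A] (.app (Proof.lam A p).shift (.var 0)) B :=
      .app ((HasType.lam hp).shift A) h0
    refine .lam ((beta hq hp1).trans (.trans ?_ (homMk_exact h)))
    refine .comp (.refl hq) hq hq ?_ hp1 hp
    have := beta hp h0
    rwa [hp.comp_var_zero] at this
  refine ⟨.lam A p, .lam B q, .lam hp, .lam hq, key hp hq ?_, key hq hp ?_⟩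
  · rw [← hp', ← hq', i.hom_inv_id]
  · rw [← hp', ← hq', i.inv_hom_id]

/-! #### Truth and conjunction -/

def toTop (A : Formula L) : A ⟶ top := homMk .unit

theorem toTop_unique (f g : A ⟶ top) : f = g := by
  obtain ⟨p, hp, rfl⟩ := exists_homMk f
  obtain ⟨q, hq, rfl⟩ := exists_homMk g
  exact Quotient.sound ((Conv.eta_top hp).trans (Conv.eta_top hq).symm)

def fst (A B : Formula L) : and A B ⟶ A := homMk (.fst .var_zero)

def snd (A B : Formula L) : and A B ⟶ B := homMk (.snd .var_zero)

def pair : (X ⟶ A) → (X ⟶ B) → (X ⟶ and A B) :=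
  Quotient.map₂ (fun p q => ⟨.pair p.1 q.1, .pair p.2 q.2⟩) fun _ _ h _ _ k => .pair h k

@[simp]
theorem pair_fst (f : X ⟶ A) (g : X ⟶ B) : pair f g ≫ fst A B = f := by
  obtain ⟨p, hp, rfl⟩ := exists_homMk f
  obtain ⟨q, hq, rfl⟩ := exists_homMk g
  exact Quotient.sound (.beta_fst hp hq)

@[simp]
theorem pair_snd (f : X ⟶ A) (g : X ⟶ B) : pair f g ≫ snd A B = g := by
  obtain ⟨p, hp, rfl⟩ := exists_homMk f
  obtain ⟨q, hq, rfl⟩ := exists_homMk g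
  exact Quotient.sound (.beta_snd hp hq)

@[simp]
theorem pair_fst_assoc (f : X ⟶ A) (g : X ⟶ B) (h : A ⟶ C) : pair f g ≫ fst A B ≫ h = f ≫ h := by
  rw [← Category.assoc, pair_fst]

@[simp]
theorem pair_snd_assoc (f : X ⟶ A) (g : X ⟶ B) (h : B ⟶ C) : pair f g ≫ snd A B ≫ h = g ≫ h := by
  rw [← Category.assoc, pair_snd]

theorem pair_eta (f : X ⟶ and A B) : pair (f ≫ fst A B) (f ≫ snd A B) = f := by
  obtain ⟨p, hp, rfl⟩ := exists_homMk f
  exact (Quotient.sound (Conv.eta_and hp)).symm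

theorem and_ext {f g : X ⟶ and A B} (h₁ : f ≫ fst A B = g ≫ fst A B)
    (h₂ : f ≫ snd A B = g ≫ snd A B) : f = g := by
  rw [← pair_eta f, ← pair_eta g, h₁, h₂]

theorem comp_pair (h : Y ⟶ X) (f : X ⟶ A) (g : X ⟶ B) :
    h ≫ pair f g = pair (h ≫ f) (h ≫ g) := by
  apply and_ext <;> simp

/-! #### Disjunction -/

def inl (A B : Formula L) : A ⟶ or A B := homMk (.inl .var_zero)

def inr (A B : Formula L) : B ⟶ or A B := homMk (.inr .var_zero)

/-- Definition by cases. -/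
def case : (A ⟶ C) → (B ⟶ C) → (or A B ⟶ C) :=
  Quotient.map₂ (fun p q => ⟨.orE (.var 0) p.1 q.1,
      .orE .var_zero (p.2.append [or A B]) (q.2.append [or A B])⟩)
    fun _ _ h _ _ k => .orE (.refl .var_zero) (h.append [or A B]) (k.append [or A B])

@[simp]
theorem inl_case (f : A ⟶ C) (g : B ⟶ C) : inl A B ≫ case f g = f := by
  obtain ⟨p, hp, rfl⟩ := exists_homMk f
  obtain ⟨q, hq, rfl⟩ := exists_homMk g
  refine Quotient.sound ?_
  have := Conv.beta_inl (Γ := [A]) .var_zero (hp.append [A]) (hq.append [A])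
  rw [hp.inst_eq_comp, hp.comp_var_zero] at this
  simp only [Proof.comp, Proof.subst, hp.subst_up, hq.subst_up]
  exact this

@[simp]
theorem inr_case (f : A ⟶ C) (g : B ⟶ C) : inr A B ≫ case f g = g := by
  obtain ⟨p, hp, rfl⟩ := exists_homMk f
  obtain ⟨q, hq, rfl⟩ := exists_homMk g
  refine Quotient.sound ?_
  have := Conv.beta_inr (Γ := [B]) .var_zero (hp.append [B]) (hq.append [B])
  rw [hq.inst_eq_comp, hq.comp_var_zero] at this
  simp only [Proof.comp, Proof.subst, hp.subst_up, hq.subst_up]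
  exact this

theorem case_eta (f : or A B ⟶ C) : case (inl A B ≫ f) (inr A B ≫ f) = f := by
  obtain ⟨p, hp, rfl⟩ := exists_homMk f
  refine (Quotient.sound ?_).symm
  have := Conv.eta_or (hp.append [or A B]) (q := .var 0) .var_zero
  rwa [hp.inst_eq_comp, hp.comp_var_zero, hp.replace_eq_comp, hp.replace_eq_comp] at this

theorem or_ext {f g : or A B ⟶ C} (h₁ : inl A B ≫ f = inl A B ≫ g)
    (h₂ : inr A B ≫ f = inr A B ≫ g) : f = g := by
  rw [← case_eta f, ← case_eta g, h₁, h₂]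

@[simp]
theorem inl_case_assoc (f : A ⟶ C) (g : B ⟶ C) (h : C ⟶ D) :
    inl A B ≫ case f g ≫ h = f ≫ h := by
  rw [← Category.assoc, inl_case]

@[simp]
theorem inr_case_assoc (f : A ⟶ C) (g : B ⟶ C) (h : C ⟶ D) :
    inr A B ≫ case f g ≫ h = g ≫ h := by
  rw [← Category.assoc, inr_case]

/-! #### Implication -/

/-- `f ∧ A`. -/
def andMap (f : X ⟶ Y) (A : Formula L) : and X A ⟶ and Y A := pair (fst X A ≫ f) (snd X A)

def curry : (and X A ⟶ B) → (X ⟶ imp A B) :=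
  have hpair : HasType [A, X] (.pair (.var 1) (.var 0)) (and X A) := .pair .var_one .var_zero
  Quotient.map (fun p => ⟨.lam A (p.1.comp (.pair (.var 1) (.var 0))), .lam (p.2.comp hpair)⟩)
    fun p p' h => .lam (.comp h p.2 p'.2 (.refl hpair) hpair hpair)

/-- Modus ponens. -/
def ev (A B : Formula L) : and (imp A B) A ⟶ B := homMk (.app (.fst .var_zero) (.snd .var_zero))

theorem andMap_curry_ev (f : and X A ⟶ B) : andMap (curry f) A ≫ ev A B = f := by
  obtain ⟨p, hp, rfl⟩ := exists_homMk f
  let a : Proof L := .var 0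
  have ha : HasType [and X A] a (and X A) := .var_zero
  let r := p.comp (.pair (.var 1) (.var 0))
  have hr : HasType [A, X] r B := hp.comp (.pair .var_one .var_zero)
  let r' := r.subst (Proof.up fun _ => .fst a)
  have hr' : HasType [A, and X A] r' B := by
    refine hr.subst _ fun n C h => ?_
    match n, h with
    | 0, h => exact .var h
    | 1, h =>
      obtain rfl : X = C := by simpa using h
      exact .fst (A := X) (B := A) .var_one
  have h1 : HasType [and X A] (.lam A r') (imp A B) := .lam hr'
  have h2 : HasType [and X A] (.snd a) A := .snd ha
  have e : r'.inst (.snd a) = p.comp (.pair (.fst a) (.snd a)) := by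
    simp only [r', r, Proof.comp, Proof.inst, Proof.subst_subst]
    rfl
  have key : Conv [and X A] (.app (.fst (.pair (.lam A r') (.snd a)))
      (.snd (.pair (.lam A r') (.snd a)))) p B := by
    refine (Conv.app (.beta_fst h1 h2) (.beta_snd h1 h2)).trans ((Conv.beta_imp hr' h2).trans ?_)
    rw [e]
    have := Conv.comp (.refl hp) hp hp (Conv.eta_and ha).symm (.pair (.fst ha) (.snd ha)) ha
    rwa [hp.comp_var_zero] at this
  exact Quotient.sound key

theorem curry_andMap_ev (f : X ⟶ imp A B) : curry (andMap f A ≫ ev A B) = f := by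
  obtain ⟨p, hp, rfl⟩ := exists_homMk f
  refine (Quotient.sound ((Conv.eta_imp hp).trans (Conv.lam ?_))).symm
  have h0 : HasType [A, X] (.var 0) A := .var_zero
  have h1 : HasType [A, X] (.var 1) X := .var_one
  have hpair : HasType [A, X] (.pair (.var 1) (.var 0)) (and X A) := .pair h1 h0
  have hfst : Conv [A, X] (.fst (.pair (.var 1) (.var 0))) (.var 1) X := .beta_fst h1 h0
  have hsnd : Conv [A, X] (.snd (.pair (.var 1) (.var 0))) (.var 0) A := .beta_snd h1 h0
  have hpc : HasType [A, X] (p.comp (.fst (.pair (.var 1) (.var 0)))) (imp A B) :=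
    hp.comp (.fst hpair)
  have key : Conv [A, X] (.app p.shift (.var 0))
      (.app (.fst (.pair (p.comp (.fst (.pair (.var 1) (.var 0))))
          (.snd (.pair (.var 1) (.var 0)))))
        (.snd (.pair (p.comp (.fst (.pair (.var 1) (.var 0))))
          (.snd (.pair (.var 1) (.var 0)))))) B := by
    refine .symm (.app ((Conv.beta_fst hpc (.snd hpair)).trans ?_)
      ((Conv.beta_snd hpc (.snd hpair)).trans hsnd))
    rw [hp.shift_eq_comp]
    exact .comp (.refl hp) hp hp hfst (.fst hpair) h1
  have e : (((Proof.app (.fst (.var 0)) (.snd (.var 0))).comp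
      (.pair (p.comp (.fst (.var 0))) (.snd (.var 0)))).comp (.pair (.var 1) (.var 0))) =
      (.app (.fst (.pair (p.comp (.fst (.pair (.var 1) (.var 0))))
          (.snd (.pair (.var 1) (.var 0)))))
        (.snd (.pair (p.comp (.fst (.pair (.var 1) (.var 0))))
          (.snd (.pair (.var 1) (.var 0)))))) := by
    simp only [Proof.comp, Proof.subst, Proof.subst_subst]
  rw [← e] at key
  exact key

/-! #### Quantifiers -/

/-- Weakening by one more individual variable, as a functor. -/
def liftFunctor (L : FirstOrder.Language.{u, v}) : Formula L ⥤ Formula L where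
  obj := lift
  map := Quotient.map (fun p => ⟨p.1.ishift, p.2.ishift⟩) fun _ _ h => h.ishift
  map_id _ := rfl
  map_comp := by
    rintro A B C ⟨p⟩ ⟨q⟩
    exact Quotient.sound
      (Conv.of_eq (q.2.comp p.2).ishift (Proof.comp_ishift q.1 p.1))

/-- The functor `liftFunctor`, with its codomain in the unfolded form. -/
def liftMap (f : A ⟶ B) : lift A ⟶ lift B := (liftFunctor L).map f

theorem liftMap_comp (f : A ⟶ B) (g : B ⟶ C) : liftMap (f ≫ g) = liftMap f ≫ liftMap g :=
  (liftFunctor L).map_comp f g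

theorem liftMap_andMap (f : X ⟶ Y) (A : Formula L) :
    liftMap (andMap f A) = andMap (liftMap f) (lift A) := by
  obtain ⟨p, hp, rfl⟩ := exists_homMk f
  exact congrArg (Quotient.mk _)
    (Subtype.ext (congrArg (fun q => Proof.pair q _) (Proof.comp_ishift p _)))

def allIntro : (lift X ⟶ A) → (X ⟶ all A) :=
  Quotient.map (fun p => ⟨.allI p.1, .allI p.2⟩) fun _ _ h => .allI h

theorem hasType_allE (A : Formula L) :
    HasType [lift (all A)] (.allE (.var 0) (FirstOrder.Language.Term.var 0)) A := by
  have := HasType.allE (Γ := [lift (all A)]) (p := .var 0) (A := A.subst (iUp iShift))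
    (FirstOrder.Language.Term.var 0) .var_zero
  rwa [inst_iUp_iShift] at this

def allElim (A : Formula L) : lift (all A) ⟶ A := homMk (hasType_allE A)

theorem liftMap_allIntro_allElim (f : lift X ⟶ A) : liftMap (allIntro f) ≫ allElim A = f := by
  obtain ⟨p, hp, rfl⟩ := exists_homMk f
  have h := hp.isubst (iUp iShift)
  have e : [lift X].map (fun B => B.subst (iUp iShift)) = [lift X].map lift := by
    simp only [List.map_cons, List.map_nil, lift_subst]
    rfl
  rw [e] at h
  have := Conv.beta_all (FirstOrder.Language.Term.var 0) h
  rw [inst_iUp_iShift, Proof.isubst_iUp_iShift_iInst] at this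
  exact Quotient.sound this

theorem allIntro_liftMap_allElim (f : X ⟶ all A) : allIntro (liftMap f ≫ allElim A) = f := by
  obtain ⟨p, hp, rfl⟩ := exists_homMk f
  exact (Quotient.sound (Conv.eta_all hp)).symm

theorem hasType_exI (A : Formula L) :
    HasType [A] (.exI (A.subst (iUp iShift)) (FirstOrder.Language.Term.var 0) (.var 0))
      (lift (ex A)) :=
  .exI _ (.var (by rw [inst_iUp_iShift]; rfl))

def exIntro (A : Formula L) : A ⟶ lift (ex A) := homMk (hasType_exI A)

def exElim : (A ⟶ lift C) → (ex A ⟶ C) :=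
  Quotient.map (fun p => ⟨.exE (.var 0) p.1, .exE .var_zero (p.2.append [lift (ex A)])⟩)
    fun _ _ h => .exE (.refl .var_zero) (h.append [lift (ex A)])

theorem exIntro_liftMap_exElim (f : A ⟶ lift C) : exIntro A ≫ liftMap (exElim f) = f := by
  obtain ⟨p, hp, rfl⟩ := exists_homMk f
  have h : HasType [A.subst (iUp iShift)] (p.isubst (iUp iShift)) C.lift.lift := by
    have := hp.isubst (iUp iShift)
    rwa [lift_subst] at this
  have h0 : HasType [A] (.var 0) ((A.subst (iUp iShift)).inst (FirstOrder.Language.Term.var 0)) :=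
    .var (by rw [inst_iUp_iShift]; rfl)
  have := Conv.beta_ex (FirstOrder.Language.Term.var 0) h0 (h.append [lift A])
  rw [Proof.isubst_iUp_iShift_iInst, hp.inst_eq_comp, hp.comp_var_zero] at this
  refine Quotient.sound ?_
  simp only [Proof.comp, Proof.ishift, Proof.isubst, Proof.subst, h.subst_up]
  exact this

theorem exElim_exIntro_liftMap (f : ex A ⟶ C) : exElim (exIntro A ≫ liftMap f) = f := by
  obtain ⟨p, hp, rfl⟩ := exists_homMk f
  refine (Quotient.sound ?_).symm
  have := Conv.eta_ex (hp.append [ex A]) (q := .var 0) .var_zero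
  rwa [hp.inst_eq_comp, hp.comp_var_zero, hp.ishift.replace_eq_comp] at this

end Formula

namespace Formula

variable {A A' B B' C D X Y : Formula L}

/-! ### Isomorphisms of formulas -/

theorem andMap_comp (f : X ⟶ Y) (g : Y ⟶ D) (A : Formula L) :
    andMap (f ≫ g) A = andMap f A ≫ andMap g A := by
  apply and_ext <;> simp [andMap]

/-- The inverse of `curry`. -/
def uncurry (f : X ⟶ imp A B) : and X A ⟶ B := andMap f A ≫ ev A B

@[simp]
theorem uncurry_curry (f : and X A ⟶ B) : uncurry (curry f) = f := andMap_curry_ev f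

@[simp]
theorem curry_uncurry (f : X ⟶ imp A B) : curry (uncurry f) = f := curry_andMap_ev f

theorem uncurry_comp (h : Y ⟶ X) (f : X ⟶ imp A B) :
    uncurry (h ≫ f) = andMap h A ≫ uncurry f := by
  simp [uncurry, andMap_comp]

theorem comp_curry (h : Y ⟶ X) (f : and X A ⟶ B) : h ≫ curry f = curry (andMap h A ≫ f) := by
  rw [← curry_uncurry (h ≫ curry f), uncurry_comp, uncurry_curry]

theorem imp_ext {f g : X ⟶ imp A B} (h : uncurry f = uncurry g) : f = g := by
  rw [← curry_uncurry f, h, curry_uncurry]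

/-- The inverse of `allIntro`. -/
def allStrip (f : X ⟶ all A) : lift X ⟶ A := liftMap f ≫ allElim A

@[simp]
theorem allStrip_allIntro (f : lift X ⟶ A) : allStrip (allIntro f) = f :=
  liftMap_allIntro_allElim f

@[simp]
theorem allIntro_allStrip (f : X ⟶ all A) : allIntro (allStrip f) = f :=
  allIntro_liftMap_allElim f

theorem allStrip_comp (h : Y ⟶ X) (f : X ⟶ all A) :
    allStrip (h ≫ f) = liftMap h ≫ allStrip f := by
  simp [allStrip, liftMap_comp]

theorem comp_allIntro (h : Y ⟶ X) (f : lift X ⟶ A) :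
    h ≫ allIntro f = allIntro (liftMap h ≫ f) := by
  rw [← allIntro_allStrip (h ≫ allIntro f), allStrip_comp, allStrip_allIntro]

theorem all_ext {f g : X ⟶ all A} (h : allStrip f = allStrip g) : f = g := by
  rw [← allIntro_allStrip f, h, allIntro_allStrip]

/-- The inverse of `exElim`. -/
def exStrip (f : ex A ⟶ C) : A ⟶ lift C := exIntro A ≫ liftMap f

@[simp]
theorem exStrip_exElim (f : A ⟶ lift C) : exStrip (exElim f) = f := exIntro_liftMap_exElim f

@[simp]
theorem exElim_exStrip (f : ex A ⟶ C) : exElim (exStrip f) = f := exElim_exIntro_liftMap f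

theorem exStrip_comp (f : ex A ⟶ C) (h : C ⟶ D) : exStrip (f ≫ h) = exStrip f ≫ liftMap h := by
  simp [exStrip, liftMap_comp]

theorem exElim_comp (f : A ⟶ lift C) (h : C ⟶ D) : exElim f ≫ h = exElim (f ≫ liftMap h) := by
  rw [← exElim_exStrip (exElim f ≫ h), exStrip_comp, exStrip_exElim]

theorem case_comp (f : A ⟶ C) (g : B ⟶ C) (h : C ⟶ D) :
    case f g ≫ h = case (f ≫ h) (g ≫ h) := by
  apply or_ext <;> simp

/-! #### Congruence -/

def andCongr (i : A ≅ A') (j : B ≅ B') : and A B ≅ and A' B' where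
  hom := pair (fst A B ≫ i.hom) (snd A B ≫ j.hom)
  inv := pair (fst A' B' ≫ i.inv) (snd A' B' ≫ j.inv)
  hom_inv_id := by apply and_ext <;> simp
  inv_hom_id := by apply and_ext <;> simp

def orCongr (i : A ≅ A') (j : B ≅ B') : or A B ≅ or A' B' where
  hom := case (i.hom ≫ inl A' B') (j.hom ≫ inr A' B')
  inv := case (i.inv ≫ inl A B) (j.inv ≫ inr A B)
  hom_inv_id := by apply or_ext <;> simp
  inv_hom_id := by apply or_ext <;> simp

theorem andMap_andCongr (h : Y ⟶ X) (i : A ≅ A') :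
    andMap h A' ≫ (andCongr (Iso.refl X) i).inv =
      (andCongr (Iso.refl Y) i).inv ≫ andMap h A := by
  apply and_ext <;> simp [andMap, andCongr]

def impCongr (i : A ≅ A') (j : B ≅ B') : imp A B ≅ imp A' B' :=
  Yoneda.ext _ _ (fun {X} f => curry ((andCongr (Iso.refl X) i).inv ≫ uncurry f ≫ j.hom))
    (fun {X} f => curry ((andCongr (Iso.refl X) i).hom ≫ uncurry f ≫ j.inv))
    (by simp) (by simp) (fun h f => by
      rw [uncurry_comp, comp_curry, Category.assoc, ← Category.assoc, ← andMap_andCongr]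
      simp)

def allCongr (i : A ≅ A') : all A ≅ all A' :=
  Yoneda.ext _ _ (fun f => allIntro (allStrip f ≫ i.hom)) (fun f => allIntro (allStrip f ≫ i.inv))
    (by simp) (by simp) (by simp [allStrip_comp, comp_allIntro])

def exCongr (i : A ≅ A') : ex A ≅ ex A' :=
  Coyoneda.ext _ _ (fun f => exElim (i.inv ≫ exStrip f)) (fun f => exElim (i.hom ≫ exStrip f))
    (by simp) (by simp) (by simp [exStrip_comp, exElim_comp])

def liftCongr (i : A ≅ A') : lift A ≅ lift A' := (liftFunctor L).mapIso i

/-! #### Products and coproducts -/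

def andTop (A : Formula L) : and A top ≅ A where
  hom := fst A top
  inv := pair (𝟙 A) (toTop A)
  hom_inv_id := by
    apply and_ext
    · simp
    · exact toTop_unique _ _

def andComm (A B : Formula L) : and A B ≅ and B A where
  hom := pair (snd A B) (fst A B)
  inv := pair (snd B A) (fst B A)
  hom_inv_id := by apply and_ext <;> simp
  inv_hom_id := by apply and_ext <;> simp

def topAnd (A : Formula L) : and top A ≅ A := andComm top A ≪≫ andTop A

def andAssoc (A B C : Formula L) : and (and A B) C ≅ and A (and B C) where
  hom := pair (fst _ _ ≫ fst A B) (pair (fst _ _ ≫ snd A B) (snd _ _))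
  inv := pair (pair (fst _ _) (snd _ _ ≫ fst B C)) (snd _ _ ≫ snd B C)
  hom_inv_id := by
    apply and_ext
    · apply and_ext <;> simp
    · simp
  inv_hom_id := by
    apply and_ext
    · simp
    · apply and_ext <;> simp

def orAssoc (A B C : Formula L) : or (or A B) C ≅ or A (or B C) where
  hom := case (case (inl _ _) (inl B C ≫ inr _ _)) (inr B C ≫ inr _ _)
  inv := case (inl A B ≫ inl _ _) (case (inr A B ≫ inl _ _) (inr _ _))
  hom_inv_id := by
    apply or_ext
    · apply or_ext <;> simp
    · simp
  inv_hom_id := by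
    apply or_ext
    · simp
    · apply or_ext <;> simp

/-! #### Implication -/

def impTop (A : Formula L) : imp A top ≅ top where
  hom := toTop _
  inv := curry (toTop _)
  hom_inv_id := imp_ext (toTop_unique _ _)
  inv_hom_id := toTop_unique _ _

def topImp (A : Formula L) : imp top A ≅ A :=
  Yoneda.ext _ _ (fun {X} f => (andTop X).inv ≫ uncurry f) (fun {X} f => curry ((andTop X).hom ≫ f))
    (by simp) (by simp) (fun {X Y} h f => by
      have : (andTop Y).inv ≫ andMap h top = h ≫ (andTop X).inv := by
        apply and_ext
        · simp [andMap, andTop]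
        · exact toTop_unique _ _
      rw [uncurry_comp, ← Category.assoc, this, Category.assoc])

def impAnd (A B C : Formula L) : imp A (and B C) ≅ and (imp A B) (imp A C) :=
  Yoneda.ext _ _
    (fun f => pair (curry (uncurry f ≫ fst _ _)) (curry (uncurry f ≫ snd _ _)))
    (fun f => curry (pair (uncurry (f ≫ fst _ _)) (uncurry (f ≫ snd _ _))))
    (by simp [pair_eta]) (by simp [pair_eta])
    (by simp [uncurry_comp, comp_pair, comp_curry])

def impImp (A B C : Formula L) : imp A (imp B C) ≅ imp (and A B) C :=
  Yoneda.ext _ _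
    (fun {X} f => curry ((andAssoc X A B).inv ≫ uncurry (uncurry f)))
    (fun {X} f => curry (curry ((andAssoc X A B).hom ≫ uncurry f)))
    (by simp) (by simp) (fun {X Y} h f => by
      have : (andAssoc Y A B).inv ≫ andMap (andMap h A) B =
          andMap h (and A B) ≫ (andAssoc X A B).inv := by
        apply and_ext
        · apply and_ext <;> simp [andMap, andAssoc]
        · simp [andMap, andAssoc]
      rw [uncurry_comp, uncurry_comp, comp_curry, ← Category.assoc, this, Category.assoc])

def andCase (f : and A X ⟶ C) (g : and B X ⟶ C) : and (or A B) X ⟶ C :=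
  uncurry (case (curry f) (curry g))

@[simp]
theorem inl_andCase (f : and A X ⟶ C) (g : and B X ⟶ C) :
    andMap (inl A B) X ≫ andCase f g = f := by
  rw [andCase, ← uncurry_comp, inl_case, uncurry_curry]

@[simp]
theorem inr_andCase (f : and A X ⟶ C) (g : and B X ⟶ C) :
    andMap (inr A B) X ≫ andCase f g = g := by
  rw [andCase, ← uncurry_comp, inr_case, uncurry_curry]

theorem andOr_ext {f g : and (or A B) X ⟶ C}
    (h₁ : andMap (inl A B) X ≫ f = andMap (inl A B) X ≫ g)
    (h₂ : andMap (inr A B) X ≫ f = andMap (inr A B) X ≫ g) : f = g := by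
  rw [← uncurry_curry f, ← uncurry_curry g]
  congr 1
  apply or_ext
  · rw [comp_curry, comp_curry, h₁]
  · rw [comp_curry, comp_curry, h₂]

def orAnd (A B C : Formula L) : and (or A B) C ≅ or (and A C) (and B C) where
  hom := andCase (inl _ _) (inr _ _)
  inv := case (andMap (inl A B) C) (andMap (inr A B) C)
  hom_inv_id := by
    apply andOr_ext
    · rw [← Category.assoc, inl_andCase, inl_case, Category.comp_id]
    · rw [← Category.assoc, inr_andCase, inr_case, Category.comp_id]
  inv_hom_id := by apply or_ext <;> simp

def orImp (A B C : Formula L) : imp (or A B) C ≅ and (imp A C) (imp B C) :=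
  Yoneda.ext _ _
    (fun {X} f =>
      pair (curry ((andComm X A).hom ≫ andMap (inl A B) X ≫ (andComm X _).inv ≫ uncurry f))
        (curry ((andComm X B).hom ≫ andMap (inr A B) X ≫ (andComm X _).inv ≫ uncurry f)))
    (fun {X} f => curry ((andComm X _).hom ≫
      andCase ((andComm X A).inv ≫ uncurry (f ≫ fst _ _)) ((andComm X B).inv ≫ uncurry (f ≫ snd _ _))))
    (fun f => by
      apply imp_ext
      rw [uncurry_curry, ← Iso.eq_inv_comp]
      apply andOr_ext <;> simp)
    (fun f => by apply and_ext <;> simp)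
    (fun {X Y} h f => by
      have key : ∀ {D E : Formula L} (k : D ⟶ E),
          (andComm Y D).hom ≫ andMap k Y ≫ (andComm Y E).inv ≫ andMap h E =
          andMap h D ≫ (andComm X D).hom ≫ andMap k X ≫ (andComm X E).inv := by
        intro D E k
        apply and_ext <;> simp [andMap, andComm]
      have key' : ∀ {D : Formula L} (k : D ⟶ or A B),
          (andComm Y D).hom ≫ andMap k Y ≫ (andComm Y _).inv ≫ andMap h _ ≫ uncurry f =
          andMap h D ≫ (andComm X D).hom ≫ andMap k X ≫ (andComm X _).inv ≫ uncurry f := by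
        intro D k
        simpa using congrArg (· ≫ uncurry f) (key k)
      simp only [uncurry_comp, comp_pair, comp_curry, key'])

/-! #### Quantifiers -/

def allTop : (all top : Formula L) ≅ top where
  hom := toTop _
  inv := allIntro (toTop _)
  hom_inv_id := all_ext (toTop_unique _ _)
  inv_hom_id := toTop_unique _ _

def allAnd (A B : Formula L) : all (and A B) ≅ and (all A) (all B) :=
  Yoneda.ext _ _
    (fun f => pair (allIntro (allStrip f ≫ fst _ _)) (allIntro (allStrip f ≫ snd _ _)))
    (fun f => allIntro (pair (allStrip (f ≫ fst _ _)) (allStrip (f ≫ snd _ _))))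
    (by simp [pair_eta]) (by simp [pair_eta])
    (by simp [allStrip_comp, comp_pair, comp_allIntro])

def liftAnd (X A : Formula L) : lift (and X A) ≅ and (lift X) (lift A) :=
  Iso.refl (and (lift X) (lift A))

theorem liftAnd_inv_liftMap (f : X ⟶ Y) (A : Formula L) :
    (liftAnd X A).inv ≫ liftMap (andMap f A) =
      andMap (liftMap f) (lift A) ≫ (liftAnd Y A).inv := by
  rw [liftMap_andMap]
  exact (Category.id_comp _).trans (Category.comp_id _).symm

def impAll (A B : Formula L) : imp A (all B) ≅ all (imp (lift A) B) :=
  Yoneda.ext _ _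
    (fun {X} f => allIntro (curry ((liftAnd X A).inv ≫ allStrip (uncurry f))))
    (fun {X} f => curry (allIntro ((liftAnd X A).hom ≫ uncurry (allStrip f))))
    (by simp) (by simp)
    (fun h f => by
      rw [uncurry_comp, allStrip_comp, comp_allIntro, comp_curry, ← Category.assoc,
        liftAnd_inv_liftMap, Category.assoc])

def exOr (A B : Formula L) : ex (or A B) ≅ or (ex A) (ex B) :=
  Coyoneda.ext _ _
    (fun f => case (exElim (inl _ _ ≫ exStrip f)) (exElim (inr _ _ ≫ exStrip f)))
    (fun f => exElim (case (exStrip (inl _ _ ≫ f)) (exStrip (inr _ _ ≫ f))))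
    (by simp [case_eta]) (by simp [case_eta])
    (by simp [exStrip_comp, case_comp, exElim_comp, liftMap_comp])

end Formula

/-! ### The classes are closed under substitution -/

namespace Formula

theorem subst_alls (k : ℕ) (A : Formula L) (σ : ℕ → L.Term ℕ) :
    (alls k A).subst σ = alls k (A.subst (iUp^[k] σ)) := by
  induction k generalizing σ with
  | zero => rfl
  | succ k ih => simp only [alls, subst, ih, Function.iterate_succ_apply]

theorem subst_exs (k : ℕ) (A : Formula L) (σ : ℕ → L.Term ℕ) :
    (exs k A).subst σ = exs k (A.subst (iUp^[k] σ)) := by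
  induction k generalizing σ with
  | zero => rfl
  | succ k ih => simp only [exs, subst, ih, Function.iterate_succ_apply]

theorem subst_conj (l : List (Formula L)) (σ : ℕ → L.Term ℕ) :
    (conj l).subst σ = conj (l.map fun A => A.subst σ) := by
  match l with
  | [] => rfl
  | [A] => rfl
  | A :: B :: l => simp only [conj, subst, List.map_cons, subst_conj (B :: l) σ]

theorem subst_disj (A : Formula L) (l : List (Formula L)) (σ : ℕ → L.Term ℕ) :
    (disj A l).subst σ = disj (A.subst σ) (l.map fun A => A.subst σ) := by
  induction l generalizing A with
  | nil => rfl
  | cons B l ih => simp only [disj, subst, List.map_cons, ih]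

end Formula

theorem IsPi.subst {A : Formula L} (h : IsPi A) (σ : ℕ → L.Term ℕ) : IsPi (A.subst σ) := by
  induction h using IsPi.rec (motive_1 := fun A _ => ∀ σ, IsSigma (A.subst σ))
    (motive_3 := fun A _ => ∀ σ, IsBase (A.subst σ)) generalizing σ with
  | disj c l hl hc h ihc ih =>
    rw [Formula.subst_disj]
    refine .disj _ _ (by simpa using hl) (ihc _) fun c' hc' => ?_
    obtain ⟨B, hB, rfl⟩ := List.mem_map.1 hc'
    exact ih B hB _
  | conj l hc hb ihc ihb =>
    have := IsPi.conj
      (l.map fun t => (t.1, t.2.1.subst (iUp^[t.1] σ), t.2.2.subst (iUp^[t.1] σ)))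
      (fun t ht => by
        obtain ⟨s, hs, rfl⟩ := List.mem_map.1 ht
        exact ihc s hs _)
      (fun t ht => by
        obtain ⟨s, hs, rfl⟩ := List.mem_map.1 ht
        exact ihb s hs _)
    simpa only [Formula.subst_conj, List.map_map, Function.comp_def, Formula.subst_alls,
      Formula.subst] using this
  | atom R ts => exact .atom R _
  | sigma _ hd ih => exact .sigma _ (ih _)
  | ex k hk c hc ih =>
    rw [Formula.subst_exs]
    exact .ex k hk _ (ih _)

/-! ### Formulas isomorphic to a formula in `Π` -/

namespace Formula

def conjCons (A : Formula L) : (l : List (Formula L)) → (conj (A :: l) ≅ and A (conj l))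
  | [] => (andTop A).symm
  | _ :: _ => Iso.refl _

def conjAppend (m : List (Formula L)) : (l : List (Formula L)) →
    (and (conj l) (conj m) ≅ conj (l ++ m))
  | [] => topAnd _
  | A :: l => andCongr (conjCons A l) (Iso.refl _) ≪≫ andAssoc _ _ _ ≪≫
      andCongr (Iso.refl A) (conjAppend m l) ≪≫ (conjCons A (l ++ m)).symm

def disjAppend (B : Formula L) (m : List (Formula L)) : (A : Formula L) → (l : List (Formula L)) →
    (or (disj A l) (disj B m) ≅ disj A (l ++ B :: m))
  | _, [] => Iso.refl _
  | A, C :: l => orAssoc A (disj C l) (disj B m) ≪≫ orCongr (Iso.refl A) (disjAppend B m C l)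

end Formula

/-- `F` is isomorphic to a formula in `Π`. -/
def EquivPi (F : Formula L) : Prop := ∃ e, IsPi e ∧ Nonempty (F ≅ e)

/-- `F` is isomorphic to a non-empty disjunction of formulas in `Π`. -/
def EquivDisj (F : Formula L) : Prop :=
  ∃ c l, IsPi c ∧ (∀ c' ∈ l, IsPi c') ∧ Nonempty (F ≅ Formula.disj c l)

theorem IsPi.top : IsPi (Formula.top : Formula L) :=
  .conj [] (by simp) (by simp)

theorem IsPi.alls_imp (k : ℕ) {c b : Formula L} (hc : IsPi c) (hb : IsBase b) :
    IsPi (Formula.alls k (.imp c b)) :=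
  .conj [(k, c, b)] (by simpa using hc) (by simpa using hb)

theorem IsPi.equivPi {F : Formula L} (h : IsPi F) : EquivPi F := ⟨F, h, ⟨Iso.refl F⟩⟩

namespace EquivPi

variable {A B F G : Formula L}

theorem of_iso (i : F ≅ G) : EquivPi G → EquivPi F
  | ⟨e, he, ⟨j⟩⟩ => ⟨e, he, ⟨i ≪≫ j⟩⟩

theorem and : EquivPi A → EquivPi B → EquivPi (.and A B)
  | ⟨_, .conj l hc hb, ⟨i⟩⟩, ⟨_, .conj m hc' hb', ⟨j⟩⟩ => by
    refine ⟨_, .conj (l ++ m) ?_ ?_, ⟨Formula.andCongr i j ≪≫ Formula.conjAppend _ _ ≪≫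
      eqToIso (by rw [List.map_append])⟩⟩
    · exact fun t ht => (List.mem_append.1 ht).elim (hc t) (hc' t)
    · exact fun t ht => (List.mem_append.1 ht).elim (hb t) (hb' t)

theorem of_isBase (h : IsBase F) : EquivPi F :=
  .of_iso (Formula.topImp F).symm (IsPi.alls_imp 0 .top h).equivPi

theorem induct {P : Formula L → Prop} (iso : ∀ {A B : Formula L}, (A ≅ B) → P B → P A)
    (top : P .top) (and : ∀ {A B}, P A → P B → P (.and A B))
    (alls : ∀ (k : ℕ) {c b}, IsPi c → IsBase b → P (.alls k (.imp c b))) (h : EquivPi F) :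
    P F := by
  obtain ⟨_, ⟨l, hc, hb⟩, ⟨i⟩⟩ := h
  refine iso i ?_
  clear i
  induction l with
  | nil => exact top
  | cons t l ih =>
    refine iso (Formula.conjCons _ _) (and (alls _ (hc t (by simp)) (hb t (by simp))) (ih ?_ ?_))
    · exact fun s hs => hc s (List.mem_cons_of_mem _ hs)
    · exact fun s hs => hb s (List.mem_cons_of_mem _ hs)

theorem all (h : EquivPi F) : EquivPi (.all F) := by
  refine h.induct (P := fun F => EquivPi (.all F)) (fun i => of_iso (Formula.allCongr i))
    (of_iso Formula.allTop IsPi.top.equivPi) (fun hA hB => of_iso (Formula.allAnd _ _) (hA.and hB))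
    fun k c b hc hb => (IsPi.alls_imp (k + 1) hc hb).equivPi

theorem lift : EquivPi F → EquivPi F.lift
  | ⟨_, he, ⟨i⟩⟩ => ⟨_, he.subst _, ⟨Formula.liftCongr i⟩⟩

theorem imp_alls (k : ℕ) {c b : Formula L} (hc : IsPi c) (hb : IsBase b) (hA : EquivPi A) :
    EquivPi (.imp A (.alls k (.imp c b))) := by
  induction k generalizing A with
  | zero =>
    obtain ⟨e, he, ⟨i⟩⟩ := hA.and hc.equivPi
    exact of_iso (Formula.impImp A c b ≪≫ Formula.impCongr i (Iso.refl b))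
      (IsPi.alls_imp 0 he hb).equivPi
  | succ k ih => exact of_iso (Formula.impAll A _) (ih hA.lift).all

theorem imp (hA : EquivPi A) (hB : EquivPi B) : EquivPi (.imp A B) :=
  hB.induct (P := fun B => EquivPi (.imp A B))
    (fun i => of_iso (Formula.impCongr (Iso.refl A) i))
    (of_iso (Formula.impTop A) IsPi.top.equivPi)
    (fun h₁ h₂ => of_iso (Formula.impAnd A _ _) (h₁.and h₂))
    fun k _ _ hc hb => imp_alls k hc hb hA

theorem equivDisj : EquivPi F → EquivDisj F
  | ⟨e, he, i⟩ => ⟨e, [], he, by simp, i⟩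

theorem ex : EquivPi F → EquivPi (.ex F)
  | ⟨e, he, ⟨i⟩⟩ => of_iso (Formula.exCongr i) (of_isBase (.ex 1 le_rfl e he))

end EquivPi

/-! ### Formulas isomorphic to a disjunction of formulas in `Π` -/

namespace EquivDisj

variable {A B F G : Formula L}

theorem of_iso (i : F ≅ G) : EquivDisj G → EquivDisj F
  | ⟨c, l, hc, hl, ⟨j⟩⟩ => ⟨c, l, hc, hl, ⟨i ≪≫ j⟩⟩

theorem or : EquivDisj A → EquivDisj B → EquivDisj (.or A B)
  | ⟨c, l, hc, hl, ⟨i⟩⟩, ⟨d, m, hd, hm, ⟨j⟩⟩ => by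
    refine ⟨c, l ++ d :: m, hc, fun c' hc' => ?_,
      ⟨Formula.orCongr i j ≪≫ Formula.disjAppend _ _ _ _⟩⟩
    rcases List.mem_append.1 hc' with h | h
    · exact hl c' h
    · rcases List.mem_cons.1 h with rfl | h
      · exact hd
      · exact hm c' h

theorem induct {P : Formula L → Prop} (iso : ∀ {A B : Formula L}, (A ≅ B) → P B → P A)
    (pi : ∀ {A}, EquivPi A → P A) (or : ∀ {A B}, P A → P B → P (.or A B)) (h : EquivDisj F) :
    P F := by
  obtain ⟨c, l, hc, hl, ⟨i⟩⟩ := h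
  refine iso i ?_
  clear i
  induction l generalizing c with
  | nil => exact pi hc.equivPi
  | cons d l ih =>
    exact or (pi hc.equivPi) (ih d (hl d (by simp)) fun c' hc' => hl c' (List.mem_cons_of_mem _ hc'))

theorem isSigma_or_isPi : EquivDisj F → ∃ e, (IsSigma e ∨ IsPi e) ∧ Nonempty (F ≅ e)
  | ⟨c, [], hc, _, i⟩ => ⟨c, .inr hc, i⟩
  | ⟨c, d :: l, hc, hl, i⟩ => ⟨_, .inl (.disj c (d :: l) (by simp) hc hl), i⟩

theorem equivPi (h : EquivDisj F) : EquivPi F := by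
  obtain ⟨e, he | he, ⟨i⟩⟩ := h.isSigma_or_isPi
  · exact .of_iso i (.of_isBase (.sigma e he))
  · exact ⟨e, he, ⟨i⟩⟩

theorem and (hA : EquivDisj A) (hB : EquivDisj B) : EquivDisj (.and A B) := by
  refine hA.induct (P := fun A => EquivDisj (.and A B))
    (fun i => of_iso (Formula.andCongr i (Iso.refl B))) (fun {A} hA => ?_)
    fun h₁ h₂ => of_iso (Formula.orAnd _ _ B) (h₁.or h₂)
  refine of_iso (Formula.andComm A B) (hB.induct (P := fun B => EquivDisj (.and B A))
    (fun i => of_iso (Formula.andCongr i (Iso.refl A))) (fun hB => (hB.and hA).equivDisj)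
    fun h₁ h₂ => of_iso (Formula.orAnd _ _ A) (h₁.or h₂))

theorem imp (hA : EquivDisj A) (hB : EquivDisj B) : EquivPi (.imp A B) :=
  hA.induct (P := fun A => EquivPi (.imp A B))
    (fun i => .of_iso (Formula.impCongr i (Iso.refl B))) (fun hA => hA.imp hB.equivPi)
    fun h₁ h₂ => .of_iso (Formula.orImp _ _ B) (h₁.and h₂)

theorem ex (h : EquivDisj F) : EquivDisj (.ex F) :=
  h.induct (P := fun F => EquivDisj (.ex F)) (fun i => of_iso (Formula.exCongr i))
    (fun hA => hA.ex.equivDisj) fun h₁ h₂ => of_iso (Formula.exOr _ _) (h₁.or h₂)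

end EquivDisj

theorem equivDisj (F : Formula L) : EquivDisj F := by
  induction F with
  | rel R ts => exact (EquivPi.of_isBase (.atom R ts)).equivDisj
  | top => exact IsPi.top.equivPi.equivDisj
  | and A B hA hB => exact hA.and hB
  | or A B hA hB => exact hA.or hB
  | imp A B hA hB => exact (hA.imp hB).equivDisj
  | all A hA => exact hA.equivPi.all.equivDisj
  | ex A hA => exact hA.ex

end IntHierarchy

theorem mainTheorem1 (L : FirstOrder.Language) (F : IntHierarchy.Formula L) :
    ∃ e : IntHierarchy.Formula L,
      (IntHierarchy.IsSigma e ∨ IntHierarchy.IsPi e) ∧ IntHierarchy.Iso F e := by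
  obtain ⟨e, he, ⟨i⟩⟩ := (IntHierarchy.equivDisj F).isSigma_or_isPi
  exact ⟨e, he, IntHierarchy.Formula.iso_of_iso i⟩
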